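/- Let $\mathbb{N}=\{1,2,3,\dots\}$, let $K$ be a field, $c\in\mathbb{N}$, and $R=K[x_{i,j}\mid 1\le i\le c,\ j\in\mathbb{N}]$. For $A\subseteq\mathbb{N}$ let $R_A\subseteq R$ be the subring of polynomials in the variables $x_{i,j}$ with $j\in A$, and let $[n]=\{1,\dots,n\}$, $R_n=R_{[n]}$. Let $\mathrm{Inc}(\mathbb{N})$ be the monoid of strictly increasing maps $p:\mathbb{N}\to\mathbb{N}$, acting on $R$ by the $K$-algebra maps with $p\cdot x_{i,j}=x_{i,p(j)}$, and let $\mathrm{Inc}(\mathbb{N})_{m,n}=\{p\in\mathrm{Inc}(\mathbb{N})\mid p(m)\le n\}$ for $m\le n$. An *$\mathrm{Inc}(\mathbb{N})$-invariant ideal chain* is a sequence $J_\circ=(J_1\subseteq J_2\subseteq\cdots)$, where $J_n$ is an ideal of $R_n$, such that $\mathrm{Inc}(\mathbb{N})_{m,n}\cdot J_m\subseteq J_n$ for all $m\le n$. Its *stability index* $\mathrm{Ind}(J_\circ)$ is the least $N\in\mathbb{N}$ with $\langle\mathrm{Inc}(\mathbb{N})_{N,n}\cdot J_N\rangle_{R_n}=J_n$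 for all $n\ge N$. The chain is *$S_\infty$-invariant* if $S_n\cdot J_m\subseteq J_n$ for all $m\le n$, where $S_n$, the group of bijections of $\mathbb{N}$ fixing every $i>n$, acts by $\sigma\cdot x_{i,j}=x_{i,\sigma(j)}$. A *term order* on $R$ is a total order $\preceq$ on the monomials of $R$ that respects multiplication and satisfies $1\preceq f$ for every monomial $f$ (it need not be a well-order). It is *$\mathrm{Inc}(\mathbb{N})$-compatible* if $f\preceq g$ implies $p\cdot f\preceq p\cdot g$ for all monomials $f,g$ and all $p\in\mathrm{Inc}(\mathbb{N})$. For an ideal $I$ of $R_A$, let $\mathrm{in}_\preceq(I)$ be the ideal of $R_A$ generated by the leading monomials of the nonzero elements of $I$; put $\mathrm{in}_\preceq(J_\circ)=(\mathrm{in}_\preceq(J_n))_{n\ge1}$. **Theorem.** Let $J_\circ$ be an $\mathrm{Inc}(\mathbb{N})$-invariant ideal chain. For every $\mathrm{Inc}(\mathbb{N})$-compatible term order $\preceq$, $\mathrm{in}_\preceq(J_\circ)$ is an $\mathrm{Inc}(\mathbb{N})$-invariant ideal chain and has a stability index; let $\mathrm{I}(J_\circ)$ be the set of all $\mathrm{Ind}(\mathrm{in}_\preceq(J_\circ))$,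 where $\preceq$ ranges over the $\mathrm{Inc}(\mathbb{N})$-compatible term orders on $R$. The following two statements are equivalent: 1. $\mathrm{I}(J_\circ)$ is bounded above. 2. The set of ideal chains $\{\mathrm{in}_\preceq(J_\circ)\mid\preceq\text{ is an }\mathrm{Inc}(\mathbb{N})\text{-compatible term order on }R\}$ is finite. Each of them implies: 3. There is $N\in\mathbb{N}$ such that $$\mathrm{in}_\preceq(J_n)=\sum_{1\le i_1<\dots<i_N\le n}\big\langle\mathrm{in}_\preceq(J_n\cap R_{\{i_1,\dots,i_N\}})\big\rangle_{R_n}$$ for all $n\ge N$ and every $\mathrm{Inc}(\mathbb{N})$-compatible term order $\preceq$ on $R$, where $J_n\cap R_{\{i_1,\dots,i_N\}}$ is regarded as an ideal of $R_{\{i_1,\dots,i_N\}}$. If $J_\circ$ is moreover $S_\infty$-invariant, then (3) is equivalent to (1) and to (2). Finally, (1), (2) and (3) hold for every $\mathrm{Inc}(\mathbb{N})$-invariant ideal chain $J_\circ$. -/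

import Mathlib

/-- The index set `[c] × ℕ` of the variables `x_{i,j}`, where `ℕ = {1, 2, 3, …}` is `ℕ+`. -/
abbrev VarIdx (c : ℕ) : Type := Fin c × ℕ+

/-- The polynomial ring `R = K[x_{i,j} | i ∈ [c], j ∈ ℕ]`. -/
abbrev BigRing (K : Type*) [Field K] (c : ℕ) : Type _ := MvPolynomial (VarIdx c) K

/-- For `A ⊆ ℕ`, the subring `R_A ⊆ R` of polynomials in the variables indexed by `[c] × A`. -/
noncomputable abbrev PolyRingOn (K : Type*) [Field K] (c : ℕ) (A : Set ℕ+) : Subalgebra K (BigRing K c) :=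
  MvPolynomial.supported K {v : VarIdx c | v.2 ∈ A}

/-- The inclusion `R_A → R_B` for `A ⊆ B`. -/
noncomputable def PolyRingOn.incl (K : Type*) [Field K] (c : ℕ) {A B : Set ℕ+} (h : A ⊆ B) :
    PolyRingOn K c A →ₐ[K] PolyRingOn K c B :=
  Subalgebra.inclusion (MvPolynomial.supported_mono fun _ hv => h hv)

/-- A sequence `J_1, J_2, …` where `J_n` is an ideal of `R_n = R_{[n]}`. -/
abbrev IdealSeq (K : Type*) [Field K] (c : ℕ) : Type _ :=
  (n : ℕ+) → Ideal (PolyRingOn K c (Set.Iic n))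

/-- An ideal of `R_A`, as a set of polynomials in `R`. -/
def polySet {K : Type*} [Field K] {c : ℕ} {A : Set ℕ+} (I : Ideal (PolyRingOn K c A)) :
    Set (BigRing K c) :=
  Subtype.val '' (I : Set (PolyRingOn K c A))

/-- The monoid `Inc(ℕ)` of strictly increasing functions on `ℕ`. -/
def IncMaps : Set (ℕ+ → ℕ+) := {p | ∀ n, p n < p (n + 1)}

/-- `Inc(ℕ)_{m,n}`, the maps `p ∈ Inc(ℕ)` with `p(m) ≤ n`. -/
def IncMapsBetween (m n : ℕ+) : Set (ℕ+ → ℕ+) := {p | p ∈ IncMaps ∧ p m ≤ n}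

/-- The `K`-linear action `x_{i,j} ↦ x_{i,p(j)}` on `R` of a self-map `p` of `ℕ`. -/
noncomputable def shiftPoly {K : Type*} [Field K] {c : ℕ} (p : ℕ+ → ℕ+) :
    BigRing K c →ₐ[K] BigRing K c :=
  MvPolynomial.rename (Prod.map id p)

/-- The action `x_{i,j} ↦ x_{i,p(j)}` on (exponent vectors of) monomials. -/
noncomputable def shiftExp {c : ℕ} (p : ℕ+ → ℕ+) (a : VarIdx c →₀ ℕ) : VarIdx c →₀ ℕ :=
  a.mapDomain (Prod.map id p)

/-- `J_1 ⊆ J_2 ⊆ …`. -/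
def IsIdealChain {K : Type*} [Field K] {c : ℕ} (J : IdealSeq K c) : Prop :=
  ∀ m n : ℕ+, m ≤ n → polySet (J m) ⊆ polySet (J n)

/-- An `Inc(ℕ)`-invariant ideal chain: `Inc(ℕ)_{m,n} · J_m ⊆ J_n` for all `m ≤ n`. -/
def IsIncInvariantChain {K : Type*} [Field K] {c : ℕ} (J : IdealSeq K c) : Prop :=
  IsIdealChain J ∧ ∀ m n : ℕ+, m ≤ n → ∀ p ∈ IncMapsBetween m n, ∀ f ∈ polySet (J m),
    shiftPoly p f ∈ polySet (J n)

/-- `S_n`, the bijections of `ℕ` that fix every `i ≥ n + 1`. -/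
def PermsUpTo (n : ℕ+) : Set (Equiv.Perm ℕ+) := {σ | ∀ i, n + 1 ≤ i → σ i = i}

/-- An `S_∞`-invariant ideal chain: `S_n · J_m ⊆ J_n` for all `m ≤ n`. -/
def IsSymInvariantChain {K : Type*} [Field K] {c : ℕ} (J : IdealSeq K c) : Prop :=
  IsIdealChain J ∧ ∀ m n : ℕ+, m ≤ n → ∀ σ ∈ PermsUpTo n, ∀ f ∈ polySet (J m),
    shiftPoly σ f ∈ polySet (J n)

/-- A term order on `R`: a total order on the monomials (given by their exponent vectors) that
respects multiplication and has `1` as least element. It need not be a well-order. -/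
structure TermOrder (c : ℕ) where
  le : (VarIdx c →₀ ℕ) → (VarIdx c →₀ ℕ) → Prop
  antisymm : ∀ a b, le a b → le b a → a = b
  trans : ∀ a b d, le a b → le b d → le a d
  total : ∀ a b, le a b ∨ le b a
  add_right : ∀ a b d, le a b → le (a + d) (b + d)
  one_le : ∀ a, le 0 a

/-- `Inc(ℕ)`-compatibility of a term order: `f ⪯ g` implies `p · f ⪯ p · g`. -/
def TermOrder.IncCompatible {c : ℕ} (T : TermOrder c) : Prop :=
  ∀ p ∈ IncMaps, ∀ a b, T.le a b → T.le (shiftExp p a) (shiftExp p b)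

/-- `a` is the exponent vector of the leading monomial of `f` (there is none if `f = 0`). -/
def TermOrder.IsLeadingExp {c : ℕ} (T : TermOrder c) {K : Type*} [Field K]
    (f : BigRing K c) (a : VarIdx c →₀ ℕ) : Prop :=
  a ∈ f.support ∧ ∀ b ∈ f.support, T.le b a

/-- The initial ideal of an ideal `I` of `R_A`: the ideal of `R_A` generated by the leading
monomials of the nonzero elements of `I`. -/
noncomputable def initialIdeal {K : Type*} [Field K] {c : ℕ} (T : TermOrder c) {A : Set ℕ+}
    (I : Ideal (PolyRingOn K c A)) : Ideal (PolyRingOn K c A) :=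
  Ideal.span {g | ∃ f ∈ I, ∃ a, T.IsLeadingExp (f : BigRing K c) a ∧
    (g : BigRing K c) = MvPolynomial.monomial a 1}

/-- The sequence of initial ideals of `J_1, J_2, …`. -/
noncomputable def initialChain {K : Type*} [Field K] {c : ℕ} (T : TermOrder c) (J : IdealSeq K c) :
    IdealSeq K c :=
  fun n => initialIdeal T (J n)

/-- `⟨Inc(ℕ)_{N,n} · J_N⟩_{R_n}`. -/
noncomputable def incSpan {K : Type*} [Field K] {c : ℕ} (J : IdealSeq K c) (N n : ℕ+) :
    Ideal (PolyRingOn K c (Set.Iic n)) :=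
  Ideal.span {g | ∃ p ∈ IncMapsBetween N n, ∃ f ∈ polySet (J N),
    (g : BigRing K c) = shiftPoly p f}

/-- The set of all `N` with `⟨Inc(ℕ)_{N,n} · J_N⟩_{R_n} = J_n` for every `n ≥ N`. -/
def stableFrom {K : Type*} [Field K] {c : ℕ} (J : IdealSeq K c) : Set ℕ+ :=
  {N | ∀ n, N ≤ n → incSpan J N n = J n}

/-- `N` is the stability index of `J`. -/
def IsStabilityIndex {K : Type*} [Field K] {c : ℕ} (J : IdealSeq K c) (N : ℕ+) : Prop :=
  IsLeast (stableFrom J) N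

/-- The set `I(J)` of stability indices of the initial ideal chains of `J` with respect to
`Inc(ℕ)`-compatible term orders. -/
def initialStabilityIndices {K : Type*} [Field K] {c : ℕ} (J : IdealSeq K c) : Set ℕ+ :=
  {N | ∃ T : TermOrder c, T.IncCompatible ∧ IsStabilityIndex (initialChain T J) N}

/-- The set of initial ideal chains of `J` with respect to `Inc(ℕ)`-compatible term orders. -/
def initialChains {K : Type*} [Field K] {c : ℕ} (J : IdealSeq K c) : Set (IdealSeq K c) :=
  {L | ∃ T : TermOrder c, T.IncCompatible ∧ L = initialChain T J}

/-- For `A ⊆ B` and an ideal `I` of `R_B`, the intersection `I ∩ R_A` as an ideal of `R_A`. -/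
noncomputable def interIdeal {K : Type*} [Field K] {c : ℕ} {A B : Set ℕ+} (h : A ⊆ B)
    (I : Ideal (PolyRingOn K c B)) : Ideal (PolyRingOn K c A) :=
  I.comap (PolyRingOn.incl K c h)

/-- There is `N` such that, for all `n ≥ N` and all `Inc(ℕ)`-compatible term orders, the initial
ideal of `J_n` is the sum, over all `N`-element subsets `A` of `[n]`, of the ideals of `R_n`
generated by the initial ideals of `J_n ∩ R_A`. -/
def InitialIdealsGeneratedByIntersections {K : Type*} [Field K] {c : ℕ}
    (J : IdealSeq K c) : Prop :=
  ∃ N : ℕ+, ∀ n : ℕ+, N ≤ n → ∀ T : TermOrder c, T.IncCompatible →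
    initialIdeal T (J n) =
      ⨆ (A : Finset ℕ+) (hA : (A : Set ℕ+) ⊆ Set.Iic n) (_ : A.card = (N : ℕ)),
        (initialIdeal T (interIdeal hA (J n))).map (PolyRingOn.incl K c hA)

/-! The theorem is a compactness statement about term orders, and (1), (2), (3) are all proved
outright; the implications between them follow from that.

By Higman's lemma, pairs (level, monomial) are well-quasi-ordered by divisibility up to `Inc(ℕ)`
(`exists_lt_incDvd`), so the leading monomials of all the `J_n` come from finitely many of them.
This gives stability of each initial chain.

A limit of term orders along an ultrafilter is a term order. Each of the finitely many generators
for the limit order is the leading monomial of one polynomial, which involves finitely many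
comparisons, so it remains a leading monomial for almost all orders of the family. Their initial
chains therefore contain that of the limit, and nested initial ideals of one ideal coincide
(`leadSet_eq_of_subset`). Hence initial chains are locally constant, and infinitely many of them
would contradict a nonprincipal ultrafilter: this is (2).

(1) follows since a chain determines its index, and (3) since a shift of a polynomial from level `M`
involves at most `M` columns. -/

/-! ### Shifts of exponent vectors -/

/-- The exponent vectors of the monomials of `R_A`. -/
def expOn (c : ℕ) (A : Set ℕ+) : Set (VarIdx c →₀ ℕ) := {a | ∀ v, a v ≠ 0 → v.2 ∈ A}

theorem strictMono_of_mem_incMaps {p : ℕ+ → ℕ+} (hp : p ∈ IncMaps) : StrictMono p := by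
  intro a b hab
  induction b using PNat.recOn with
  | one => exact absurd hab not_lt_one
  | succ n ih =>
    rcases (PNat.lt_add_one_iff.1 hab).lt_or_eq with h | rfl
    · exact (ih h).trans (hp n)
    · exact hp a

theorem StrictMono.mem_incMaps {p : ℕ+ → ℕ+} (hp : StrictMono p) : p ∈ IncMaps :=
  fun n => hp (PNat.lt_add_right n 1)

theorem prodMap_injective_of_mem_incMaps {c : ℕ} {p : ℕ+ → ℕ+} (hp : p ∈ IncMaps) :
    Function.Injective (Prod.map id p : VarIdx c → VarIdx c) :=
  Function.injective_id.prodMap (strictMono_of_mem_incMaps hp).injective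

theorem shiftExp_apply {c : ℕ} {p : ℕ+ → ℕ+} (hp : p ∈ IncMaps) (a : VarIdx c →₀ ℕ)
    (v : VarIdx c) : shiftExp p a (v.1, p v.2) = a v :=
  Finsupp.mapDomain_apply (prodMap_injective_of_mem_incMaps hp) a v

theorem exists_of_shiftExp_ne_zero {c : ℕ} {p : ℕ+ → ℕ+} {a : VarIdx c →₀ ℕ} {v : VarIdx c}
    (h : shiftExp p a v ≠ 0) : ∃ w, a w ≠ 0 ∧ v = (w.1, p w.2) := by
  classical
  have := Finsupp.mapDomain_support (Finsupp.mem_support_iff.2 h)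
  obtain ⟨w, hw, rfl⟩ := Finset.mem_image.1 this
  exact ⟨w, Finsupp.mem_support_iff.1 hw, rfl⟩

theorem shiftExp_le {c : ℕ} {p : ℕ+ → ℕ+} (hp : p ∈ IncMaps) {a b : VarIdx c →₀ ℕ}
    (h : ∀ v, a v ≠ 0 → a v ≤ b (v.1, p v.2)) : shiftExp p a ≤ b := by
  intro v
  by_cases hv : shiftExp p a v = 0
  · simp [hv]
  · obtain ⟨w, hw, rfl⟩ := exists_of_shiftExp_ne_zero hv
    rw [shiftExp_apply hp]
    exact h w hw

theorem shiftExp_mem_expOn {c : ℕ} {p : ℕ+ → ℕ+} {A B : Set ℕ+} (h : Set.MapsTo p A B)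
    {a : VarIdx c →₀ ℕ} (ha : a ∈ expOn c A) : shiftExp p a ∈ expOn c B := by
  intro v hv
  obtain ⟨w, hw, rfl⟩ := exists_of_shiftExp_ne_zero hv
  exact h (ha w hw)

theorem mapsTo_Iic_of_mem_incMapsBetween {m n : ℕ+} {p : ℕ+ → ℕ+} (hp : p ∈ IncMapsBetween m n) :
    Set.MapsTo p (Set.Iic m) (Set.Iic n) :=
  fun _ hj => ((strictMono_of_mem_incMaps hp.1).monotone hj).trans hp.2

theorem id_mem_incMapsBetween {m n : ℕ+} (h : m ≤ n) : id ∈ IncMapsBetween m n :=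
  ⟨strictMono_id.mem_incMaps, h⟩

/-- A map in `Inc(ℕ)_{m,n}` factors through every intermediate level. -/
theorem exists_comp_of_mem_incMapsBetween {m N n : ℕ+} (hmN : m ≤ N) (hNn : N ≤ n) {p : ℕ+ → ℕ+}
    (hp : p ∈ IncMapsBetween m n) :
    ∃ r ∈ IncMapsBetween m N, ∃ q ∈ IncMapsBetween N n, ∀ j ≤ m, q (r j) = p j := by
  rcases hmN.eq_or_lt with rfl | hlt
  · exact ⟨id, id_mem_incMapsBetween le_rfl, p, hp, fun _ _ => rfl⟩
  have hsub : ∀ {i k : ℕ+}, i < k → ∃ j, k = i + j :=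
    fun h => ⟨_, (PNat.add_sub_of_lt h).symm⟩
  obtain ⟨d, rfl⟩ := hsub hlt
  have hmono := strictMono_of_mem_incMaps hp.1
  have hle : ∀ j, j ≤ p j := hmono.id_le
  -- With `N = d + m`, take `r j = min (p j) (d + j)`, and let `q` be the identity up to `d` and
  -- send `d + j` to `max (d + j) (p j)`.
  have hq : ∀ j, (fun i => if i ≤ d then i else max i (p (i - d)) : ℕ+ → ℕ+) (d + j) =
      max (d + j) (p j) := by
    intro j
    have h1 : ¬ d + j ≤ d := not_le.2 (PNat.lt_add_right d j)
    have h2 : d + j - d = j := by rw [add_comm, PNat.add_sub]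
    simp only [h1, h2, if_false]
  have hq' : ∀ j ≤ d, (fun i => if i ≤ d then i else max i (p (i - d)) : ℕ+ → ℕ+) j = j :=
    fun j hj => if_pos hj
  generalize (fun i => if i ≤ d then i else max i (p (i - d)) : ℕ+ → ℕ+) = q at hq hq'
  refine ⟨fun j => min (p j) (d + j), ⟨StrictMono.mem_incMaps fun a b hab => ?_, ?_⟩, q,
    ⟨StrictMono.mem_incMaps fun a b hab => ?_, ?_⟩, fun j _ => ?_⟩
  · exact min_lt_min (hmono hab) (add_lt_add_right hab d)
  · rw [add_comm m d]; exact min_le_right _ _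
  · rcases le_or_gt b d with hb | hb
    · rw [hq' b hb, hq' a (hab.le.trans hb)]; exact hab
    · obtain ⟨b, rfl⟩ := hsub hb
      rw [hq]
      rcases le_or_gt a d with ha | ha
      · rw [hq' a ha]; exact hab.trans_le (le_max_left _ _)
      · obtain ⟨a, rfl⟩ := hsub ha
        rw [hq]
        exact max_lt_max hab (hmono (lt_of_add_lt_add_left hab))
  · rw [add_comm m d] at hNn ⊢
    rw [hq]
    exact max_le hNn hp.2
  · rcases le_or_gt (p j) (d + j) with h | h
    · simp only [min_eq_left h]
      rcases le_or_gt (p j) d with h' | h'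
      · exact hq' _ h'
      · obtain ⟨k, hk⟩ := hsub h'
        rw [hk, hq, ← hk]
        -- Here `p j = d + k ≤ d + j`, so `k ≤ j` and `p k ≤ p j`: `q` fixes `p j`.
        refine max_eq_left (hmono.monotone ?_)
        rw [hk] at h
        exact le_of_add_le_add_left h
    · simp only [min_eq_right h.le]
      rw [hq, max_eq_right h.le]

theorem shiftExp_comp {c : ℕ} (q r : ℕ+ → ℕ+) (a : VarIdx c →₀ ℕ) :
    shiftExp q (shiftExp r a) = shiftExp (q ∘ r) a := by
  unfold shiftExp
  rw [← Finsupp.mapDomain_comp]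
  rfl

theorem shiftExp_congr {c : ℕ} {p q : ℕ+ → ℕ+} {A : Set ℕ+} (h : Set.EqOn p q A)
    {a : VarIdx c →₀ ℕ} (ha : a ∈ expOn c A) : shiftExp p a = shiftExp q a := by
  refine Finsupp.mapDomain_congr fun v hv => ?_
  have := h (ha v (Finsupp.mem_support_iff.1 hv))
  simp [Prod.map, this]

/-! ### Well-quasi-order on monomials -/

/-- `(m, a)` divides `(n, b)` if `b` is a multiple of `p · a` for some `p ∈ Inc(ℕ)_{m,n}`. -/
def IncDvd {c : ℕ} (x y : ℕ+ × (VarIdx c →₀ ℕ)) : Prop :=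
  x.1 ≤ y.1 ∧ ∃ p ∈ IncMapsBetween x.1 y.1, shiftExp p x.2 ≤ y.2

/-- The word of length `n` over `ℕ^c` encoding an exponent vector in the first `n` columns. -/
def expWord {c : ℕ} (x : ℕ+ × (VarIdx c →₀ ℕ)) : List (Fin c → ℕ) :=
  List.ofFn fun j : Fin x.1 => fun i => x.2 (i, j.1.succPNat)

/-- Letters are columns, so the positions of the dominating letters in the larger word give the
values of `p` on the columns of the smaller one. -/
theorem IncDvd.of_sublistForall₂ {c : ℕ} {x y : ℕ+ × (VarIdx c →₀ ℕ)}
    (hx : x.2 ∈ expOn c (Set.Iic x.1))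
    (h : List.SublistForall₂ (· ≤ ·) (expWord x) (expWord y)) : IncDvd x y := by
  obtain ⟨l, hl, hsub⟩ := List.sublistForall₂_iff.1 h
  obtain ⟨f, hf⟩ := List.sublist_iff_exists_orderEmbedding_getElem?_eq.1 hsub
  have hlen : l.length = x.1 := by rw [← hl.length_eq, expWord, List.length_ofFn]
  have key : ∀ k : ℕ, k < x.1 → f k < y.1 ∧
      ∀ i, x.2 (i, k.succPNat) ≤ y.2 (i, (f k).succPNat) := by
    intro k hk
    have h1 := hf k
    rw [List.getElem?_eq_getElem (hlen ▸ hk)] at h1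
    obtain ⟨h2, h3⟩ := List.getElem?_eq_some_iff.1 h1.symm
    have h4 : f k < y.1 := by simpa [expWord] using h2
    refine ⟨h4, ?_⟩
    have h5 := hl.get (i := k) (by simpa [expWord] using hk) (hlen ▸ hk)
    simp only [List.get_eq_getElem] at h5
    rw [← h3] at h5
    simp only [expWord, List.getElem_ofFn] at h5
    exact h5
  -- `f` embeds all of `ℕ`, so past the end of the word it already supplies the rest of `p`.
  have hmono : StrictMono fun j : ℕ+ => (f j.natPred).succPNat := by
    intro a b hab
    simpa using hab
  have hmem : (fun j : ℕ+ => (f j.natPred).succPNat) ∈ IncMapsBetween x.1 y.1 := by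
    refine ⟨hmono.mem_incMaps, ?_⟩
    have := (key x.1.natPred (by have := PNat.natPred_add_one x.1; omega)).1
    rw [← PNat.coe_le_coe, Nat.succPNat_coe]
    exact this
  refine ⟨(hmono.id_le x.1).trans hmem.2, _, hmem, shiftExp_le hmem.1 ?_⟩
  rintro ⟨i, j⟩ hv
  have hj : j ≤ x.1 := hx _ hv
  have := (key j.natPred (by
    have := PNat.natPred_add_one j; have := PNat.coe_le_coe j x.1 |>.2 hj; omega)).2 i
  simpa using this

/-- The monomials of the rings `R_n` are well-quasi-ordered by `IncDvd`. -/
theorem exists_lt_incDvd {c : ℕ} (f : ℕ → ℕ+ × (VarIdx c →₀ ℕ))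
    (hf : ∀ k, (f k).2 ∈ expOn c (Set.Iic (f k).1)) : ∃ i j, i < j ∧ IncDvd (f i) (f j) := by
  -- Higman's lemma over the alphabet `ℕ^c`, which is well-quasi-ordered by Dickson's lemma.
  have h := Set.PartiallyWellOrderedOn.partiallyWellOrderedOn_sublistForall₂
    (α := Fin c → ℕ) (· ≤ ·) (s := Set.univ) (Set.isPWO_of_wellQuasiOrderedLE _)
  obtain ⟨i, j, hij, hle⟩ := h fun k => ⟨expWord (f k), fun _ _ => Set.mem_univ _⟩
  exact ⟨i, j, hij, .of_sublistForall₂ (hf i) hle⟩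

/-- Otherwise, repeatedly choosing an element divisible by none of the previous ones gives a bad
sequence. -/
theorem exists_finset_incDvd {c : ℕ} (U : Set (ℕ+ × (VarIdx c →₀ ℕ)))
    (hU : ∀ x ∈ U, x.2 ∈ expOn c (Set.Iic x.1)) :
    ∃ G : Finset (ℕ+ × (VarIdx c →₀ ℕ)), (∀ x ∈ G, x ∈ U) ∧ ∀ y ∈ U, ∃ x ∈ G, IncDvd x y := by
  by_contra! h
  obtain ⟨f, hf, hf'⟩ := exists_seq_of_forall_finset_exists (· ∈ U) (fun x y => ¬ IncDvd x y) h
  obtain ⟨i, j, hij, hd⟩ := exists_lt_incDvd f fun k => hU _ (hf k)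
  exact hf' i j hij hd

/-! ### Term orders on finitely many columns -/

theorem TermOrder.le_of_le {c : ℕ} (T : TermOrder c) {a b : VarIdx c →₀ ℕ} (h : a ≤ b) :
    T.le a b := by
  obtain ⟨d, rfl⟩ := exists_add_of_le h
  simpa [add_comm] using T.add_right 0 d a (T.one_le d)

theorem TermOrder.refl {c : ℕ} (T : TermOrder c) (a : VarIdx c →₀ ℕ) : T.le a a :=
  T.le_of_le le_rfl

/-- A term order restricts to a well-order on the monomials of `R_A` for finite `A`. -/
theorem TermOrder.wellFounded {c : ℕ} (T : TermOrder c) {A : Set ℕ+} (hA : A.Finite) :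
    WellFounded fun a b : expOn c A => ¬ T.le b.1 a.1 := by
  have : IsTrans (expOn c A) fun a b => ¬ T.le b.1 a.1 :=
    ⟨fun a b d hab hbd h => (T.total a b).elim (fun h' => hbd (T.trans _ _ _ h h')) hab⟩
  have : Std.Irrefl fun a b : expOn c A => ¬ T.le b.1 a.1 := ⟨fun a h => h (T.refl _)⟩
  have : IsStrictOrder (expOn c A) fun a b => ¬ T.le b.1 a.1 := {}
  rw [RelEmbedding.wellFounded_iff_isEmpty]
  refine ⟨fun f => ?_⟩
  have : Finite A := hA
  -- Dickson's lemma: in a strictly descending sequence some earlier monomial would divide a later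
  -- one.
  obtain ⟨i, j, hij, h⟩ := wellQuasiOrdered_le (α := Fin c × A → ℕ)
    fun k v => (f k).1 (v.1, v.2)
  refine f.map_rel_iff.2 (show j > i from hij) (T.le_of_le fun v => ?_)
  by_cases hv : (f i).1 v = 0
  · simp [hv]
  · exact h (v.1, ⟨v.2, (f i).2 v hv⟩)

/-! ### The rings `R_A` and shifts between them -/

theorem mem_polySet {K : Type*} [Field K] {c : ℕ} {A : Set ℕ+} {I : Ideal (PolyRingOn K c A)}
    {f : BigRing K c} : f ∈ polySet I ↔
      ∃ h : f ∈ PolyRingOn K c A, (⟨f, h⟩ : PolyRingOn K c A) ∈ I := by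
  simp [polySet]

theorem coe_mem_polySet {K : Type*} [Field K] {c : ℕ} {A : Set ℕ+} {I : Ideal (PolyRingOn K c A)}
    {f : PolyRingOn K c A} : (f : BigRing K c) ∈ polySet I ↔ f ∈ I := by
  simp [polySet]

theorem mem_polyRingOn {K : Type*} [Field K] {c : ℕ} {A : Set ℕ+} {f : BigRing K c} :
    f ∈ PolyRingOn K c A ↔ ∀ a ∈ f.support, a ∈ expOn c A := by
  rw [MvPolynomial.mem_supported]
  constructor
  · intro h a ha v hv
    exact h ((MvPolynomial.mem_vars_iff_mem_support v).2 ⟨a, ha, Finsupp.mem_support_iff.2 hv⟩)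
  · intro h v hv
    obtain ⟨a, ha, hav⟩ := (MvPolynomial.mem_vars_iff_mem_support v).1 hv
    exact h a ha v (Finsupp.mem_support_iff.1 hav)

theorem monomial_mem_polyRingOn {K : Type*} [Field K] {c : ℕ} {A : Set ℕ+} {a : VarIdx c →₀ ℕ}
    (ha : a ∈ expOn c A) (k : K) : MvPolynomial.monomial a k ∈ PolyRingOn K c A := by
  refine mem_polyRingOn.2 fun b hb => ?_
  rwa [Finset.mem_singleton.1 (MvPolynomial.support_monomial_subset hb)]

theorem shiftPoly_mem_polyRingOn {K : Type*} [Field K] {c : ℕ} {p : ℕ+ → ℕ+} {A B : Set ℕ+}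
    (h : Set.MapsTo p A B) {f : BigRing K c} (hf : f ∈ PolyRingOn K c A) :
    shiftPoly p f ∈ PolyRingOn K c B := by
  classical
  rw [mem_polyRingOn] at hf ⊢
  intro a ha
  obtain ⟨b, hb, hab⟩ := MvPolynomial.coeff_rename_ne_zero _ _ _ (MvPolynomial.mem_support_iff.1 ha)
  rw [← hb]
  exact shiftExp_mem_expOn h (hf b (MvPolynomial.mem_support_iff.2 hab))

/-- The action of `p` as a map `R_A → R_B`, where `p` maps `A` to `B`. -/
noncomputable def shiftHom (K : Type*) [Field K] (c : ℕ) {p : ℕ+ → ℕ+} {A B : Set ℕ+}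
    (h : Set.MapsTo p A B) : PolyRingOn K c A →ₐ[K] PolyRingOn K c B :=
  ((shiftPoly p).comp (PolyRingOn K c A).val).codRestrict _
    fun g => shiftPoly_mem_polyRingOn h g.2

theorem coe_shiftHom {K : Type*} [Field K] {c : ℕ} {p : ℕ+ → ℕ+} {A B : Set ℕ+}
    (h : Set.MapsTo p A B) (f : PolyRingOn K c A) :
    (shiftHom K c h f : BigRing K c) = shiftPoly p f :=
  AlgHom.coe_codRestrict _ _ _ f

theorem support_shiftPoly {K : Type*} [Field K] {c : ℕ} {p : ℕ+ → ℕ+} (hp : p ∈ IncMaps)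
    (f : BigRing K c) (a : VarIdx c →₀ ℕ) :
    a ∈ (shiftPoly p f).support ↔ ∃ b ∈ f.support, shiftExp p b = a := by
  classical
  rw [shiftPoly, MvPolynomial.support_rename_of_injective (prodMap_injective_of_mem_incMaps hp),
    Finset.mem_image]
  rfl

theorem shiftPoly_monomial {K : Type*} [Field K] {c : ℕ} (p : ℕ+ → ℕ+) (a : VarIdx c →₀ ℕ)
    (k : K) : shiftPoly p (MvPolynomial.monomial a k : BigRing K c) =
      MvPolynomial.monomial (shiftExp p a) k :=
  MvPolynomial.rename_monomial _ _ _

/-! ### Leading exponents, normal forms and comparison of initial ideals -/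

/-- The exponent vectors of the leading monomials of the elements of `I`. -/
def leadSet {K : Type*} [Field K] {c : ℕ} (T : TermOrder c) {A : Set ℕ+}
    (I : Ideal (PolyRingOn K c A)) : Set (VarIdx c →₀ ℕ) :=
  {a | ∃ f ∈ polySet I, T.IsLeadingExp f a}

theorem initialIdeal_eq_span {K : Type*} [Field K] {c : ℕ} (T : TermOrder c) {A : Set ℕ+}
    (I : Ideal (PolyRingOn K c A)) :
    initialIdeal T I = Ideal.span
      {g : PolyRingOn K c A | ∃ a ∈ leadSet T I, (g : BigRing K c) = MvPolynomial.monomial a 1} := by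
  unfold initialIdeal
  congr 1
  ext g
  constructor
  · rintro ⟨f, hf, a, ha, hg⟩
    exact ⟨a, ⟨f, coe_mem_polySet.2 hf, ha⟩, hg⟩
  · rintro ⟨a, ⟨_, ⟨f, hf, rfl⟩, ha⟩, hg⟩
    exact ⟨f, hf, a, ha, hg⟩

theorem initialIdeal_congr {K : Type*} [Field K] {c : ℕ} {T T' : TermOrder c} {A : Set ℕ+}
    {I : Ideal (PolyRingOn K c A)} (h : leadSet T I = leadSet T' I) :
    initialIdeal T I = initialIdeal T' I := by
  rw [initialIdeal_eq_span, initialIdeal_eq_span, h]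

theorem leadSet_subset_expOn {K : Type*} [Field K] {c : ℕ} (T : TermOrder c) {A : Set ℕ+}
    (I : Ideal (PolyRingOn K c A)) : leadSet T I ⊆ expOn c A := by
  rintro a ⟨f, hf, ha⟩
  exact mem_polyRingOn.1 (mem_polySet.1 hf).1 a ha.1

theorem monomial_mem_initialIdeal {K : Type*} [Field K] {c : ℕ} {T : TermOrder c} {A : Set ℕ+}
    {I : Ideal (PolyRingOn K c A)} {a : VarIdx c →₀ ℕ} (ha : a ∈ leadSet T I)
    {g : PolyRingOn K c A} (hg : (g : BigRing K c) = MvPolynomial.monomial a 1) :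
    g ∈ initialIdeal T I := by
  rw [initialIdeal_eq_span]
  exact Ideal.subset_span ⟨a, ha, hg⟩

theorem TermOrder.IsLeadingExp.shift {K : Type*} [Field K] {c : ℕ} {T : TermOrder c}
    (hT : T.IncCompatible) {p : ℕ+ → ℕ+} (hp : p ∈ IncMaps) {f : BigRing K c}
    {a : VarIdx c →₀ ℕ} (h : T.IsLeadingExp f a) :
    T.IsLeadingExp (shiftPoly p f) (shiftExp p a) := by
  refine ⟨(support_shiftPoly hp _ _).2 ⟨a, h.1, rfl⟩, fun b hb => ?_⟩
  obtain ⟨d, hd, rfl⟩ := (support_shiftPoly hp _ _).1 hb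
  exact hT p hp _ _ (h.2 d hd)

theorem TermOrder.IsLeadingExp.mul_monomial {K : Type*} [Field K] {c : ℕ} {T : TermOrder c}
    {f : BigRing K c} {a : VarIdx c →₀ ℕ} (h : T.IsLeadingExp f a) (d : VarIdx c →₀ ℕ) :
    T.IsLeadingExp (f * MvPolynomial.monomial d 1) (a + d) := by
  classical
  refine ⟨?_, fun b hb => ?_⟩
  · rw [MvPolynomial.mem_support_iff, MvPolynomial.coeff_mul_monomial, mul_one]
    exact MvPolynomial.mem_support_iff.1 h.1
  · rw [MvPolynomial.mem_support_iff, MvPolynomial.coeff_mul_monomial'] at hb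
    split_ifs at hb with hd
    · rw [mul_one] at hb
      rw [← tsub_add_cancel_of_le hd]
      exact T.add_right _ _ _ (h.2 _ (MvPolynomial.mem_support_iff.2 hb))
    · exact absurd rfl hb

theorem mem_leadSet_of_le {K : Type*} [Field K] {c : ℕ} {T : TermOrder c} {A : Set ℕ+}
    {I : Ideal (PolyRingOn K c A)} {a b : VarIdx c →₀ ℕ} (ha : a ∈ leadSet T I) (hab : a ≤ b)
    (hb : b ∈ expOn c A) : b ∈ leadSet T I := by
  obtain ⟨d, rfl⟩ := exists_add_of_le hab
  obtain ⟨_, ⟨f, hf, rfl⟩, ha⟩ := ha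
  have hd : d ∈ expOn c A := fun v hv => hb v (by simp [hv])
  refine ⟨_, ⟨f * ⟨_, monomial_mem_polyRingOn hd 1⟩, I.mul_mem_right _ hf, rfl⟩, ?_⟩
  exact ha.mul_monomial d

theorem TermOrder.exists_isLeadingExp {K : Type*} [Field K] {c : ℕ} (T : TermOrder c)
    {f : BigRing K c} (hf : f ≠ 0) : ∃ a, T.IsLeadingExp f a := by
  have key : ∀ s : Finset (VarIdx c →₀ ℕ), s.Nonempty → ∃ a ∈ s, ∀ b ∈ s, T.le b a := by
    intro s hs
    induction hs using Finset.Nonempty.cons_induction with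
    | singleton a => exact ⟨a, by simp, by simpa using T.refl a⟩
    | cons a s h hs ih =>
      obtain ⟨m, hm, hmax⟩ := ih
      rcases T.total a m with h | h
      · exact ⟨m, by simp [hm], by simpa using ⟨h, hmax⟩⟩
      · exact ⟨a, by simp, by simpa using ⟨T.refl a, fun b hb => T.trans _ _ _ (hmax b hb) h⟩⟩
  exact key _ (MvPolynomial.support_nonempty.2 hf)

/-- Modulo `I`, every polynomial is a combination of standard monomials. -/
theorem exists_normalForm {K : Type*} [Field K] {c : ℕ} (T : TermOrder c) {A : Set ℕ+}
    (hA : A.Finite) (I : Ideal (PolyRingOn K c A)) {f : BigRing K c} (hf : f ∈ PolyRingOn K c A) :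
    ∃ r, f - r ∈ polySet I ∧ ∀ b ∈ r.support, b ∉ leadSet T I := by
  classical
  -- `P` is `I` as a subspace of `R`, and `S` is spanned by the monomials outside `leadSet T I`; the
  -- claim is that `P ⊔ S` contains `R_A`.
  let P : Submodule K (BigRing K c) :=
    (I.restrictScalars K).map (PolyRingOn K c A).val.toLinearMap
  let S : Submodule K (BigRing K c) := MvPolynomial.restrictSupport K (leadSet T I)ᶜ
  have hP : ∀ g, g ∈ P ↔ g ∈ polySet I := fun g => Iff.rfl
  have hsum : ∀ g : BigRing K c, (∀ a ∈ g.support, MvPolynomial.monomial a (1 : K) ∈ P ⊔ S) →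
      g ∈ P ⊔ S := by
    intro g hg
    rw [g.as_sum]
    refine Submodule.sum_mem _ fun a ha => ?_
    have := (P ⊔ S).smul_mem (g.coeff a) (hg a ha)
    rwa [MvPolynomial.smul_monomial, smul_eq_mul, mul_one] at this
  have hmon : ∀ a : expOn c A, MvPolynomial.monomial a.1 (1 : K) ∈ P ⊔ S := by
    intro a
    induction a using (T.wellFounded hA).induction with
    | _ a ih =>
    by_cases ha : a.1 ∈ leadSet T I
    · obtain ⟨g, hg, hga⟩ := ha
      have h0 : g.coeff a.1 ≠ 0 := MvPolynomial.mem_support_iff.1 hga.1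
      -- Cancelling the leading term of `g` leaves only strictly smaller monomials, covered by
      -- induction.
      have h1 : MvPolynomial.monomial a.1 (g.coeff a.1) - g ∈ P ⊔ S := by
        refine hsum _ fun b hb => ?_
        have hba : b ≠ a.1 := by
          rintro rfl
          simp at hb
        have hbg : b ∈ g.support := by
          rw [MvPolynomial.mem_support_iff] at hb ⊢
          simpa [MvPolynomial.coeff_monomial, hba.symm] using hb
        exact ih ⟨b, mem_polyRingOn.1 (mem_polySet.1 hg).1 b hbg⟩
          fun h => hba (T.antisymm _ _ (hga.2 b hbg) h)
      have h2 := (P ⊔ S).add_mem h1 (Submodule.mem_sup_left ((hP g).2 hg))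
      have h3 := (P ⊔ S).smul_mem (g.coeff a.1)⁻¹ h2
      rwa [sub_add_cancel, MvPolynomial.smul_monomial, smul_eq_mul, inv_mul_cancel₀ h0] at h3
    · refine Submodule.mem_sup_right fun b hb => ?_
      rw [Finset.mem_singleton.1 (MvPolynomial.support_monomial_subset hb)]
      exact ha
  obtain ⟨g, hg, r, hr, rfl⟩ := Submodule.mem_sup.1
    (hsum f fun a ha => hmon ⟨a, mem_polyRingOn.1 hf a ha⟩)
  exact ⟨r, by simpa using (hP g).1 hg, fun b hb => hr hb⟩

/-- Inclusions between initial ideals of the same ideal are equalities. -/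
theorem leadSet_eq_of_subset {K : Type*} [Field K] {c : ℕ} {T T' : TermOrder c} {A : Set ℕ+}
    (hA : A.Finite) {I : Ideal (PolyRingOn K c A)} (h : leadSet T I ⊆ leadSet T' I) :
    leadSet T I = leadSet T' I := by
  classical
  refine h.antisymm fun a ha => ?_
  by_contra hna
  -- Reduce with respect to `T'`, but take the leading exponent `b` of `a - r ∈ I` with respect to
  -- `T`. Either `b = a`, or `b` occurs in `r` and is standard for `T'`; both contradict `b ∈
  -- leadSet T I ⊆ leadSet T' I`.
  obtain ⟨r, hr, hstd⟩ := exists_normalForm T' hA I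
    (monomial_mem_polyRingOn (leadSet_subset_expOn T' I ha) (1 : K))
  have har : r.coeff a = 0 := by
    by_contra h0
    exact hstd a (MvPolynomial.mem_support_iff.2 h0) ha
  have hne : MvPolynomial.monomial a (1 : K) - r ≠ 0 := by
    intro h0
    have := congrArg (MvPolynomial.coeff a) h0
    simp [har] at this
  obtain ⟨b, hb⟩ := T.exists_isLeadingExp hne
  have hbl : b ∈ leadSet T I := ⟨_, hr, hb⟩
  by_cases hba : b = a
  · exact hna (hba ▸ hbl)
  · refine hstd b ?_ (h hbl)
    have := MvPolynomial.mem_support_iff.1 hb.1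
    rw [MvPolynomial.mem_support_iff]
    simpa [MvPolynomial.coeff_monomial, Ne.symm hba] using this

/-! ### Invariance and stability of initial chains -/

theorem shiftExp_mem_leadSet {K : Type*} [Field K] {c : ℕ} {J : IdealSeq K c}
    (hJ : IsIncInvariantChain J) {T : TermOrder c} (hT : T.IncCompatible) {m n : ℕ+} (hmn : m ≤ n)
    {p : ℕ+ → ℕ+} (hp : p ∈ IncMapsBetween m n) {a : VarIdx c →₀ ℕ} (ha : a ∈ leadSet T (J m)) :
    shiftExp p a ∈ leadSet T (J n) := by
  obtain ⟨f, hf, hfa⟩ := ha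
  exact ⟨_, hJ.2 m n hmn p hp f hf, hfa.shift hT hp.1⟩

theorem mem_leadSet_of_incDvd {K : Type*} [Field K] {c : ℕ} {J : IdealSeq K c}
    (hJ : IsIncInvariantChain J) {T : TermOrder c} (hT : T.IncCompatible)
    {x y : ℕ+ × (VarIdx c →₀ ℕ)} (hxy : IncDvd x y) (hx : x.2 ∈ leadSet T (J x.1))
    (hy : y.2 ∈ expOn c (Set.Iic y.1)) : y.2 ∈ leadSet T (J y.1) := by
  obtain ⟨hmn, p, hp, hle⟩ := hxy
  exact mem_leadSet_of_le (shiftExp_mem_leadSet hJ hT hmn hp hx) hle hy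

theorem shiftPoly_mem_initialChain {K : Type*} [Field K] {c : ℕ} {J : IdealSeq K c}
    (hJ : IsIncInvariantChain J) {T : TermOrder c} (hT : T.IncCompatible) {m n : ℕ+} (hmn : m ≤ n)
    {p : ℕ+ → ℕ+} (hp : p ∈ IncMapsBetween m n) {f : BigRing K c}
    (hf : f ∈ polySet (initialChain T J m)) : shiftPoly p f ∈ polySet (initialChain T J n) := by
  obtain ⟨f, hf, rfl⟩ := hf
  have hmaps := mapsTo_Iic_of_mem_incMapsBetween hp
  suffices h : initialChain T J m ≤ (initialChain T J n).comap (shiftHom K c hmaps) by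
    rw [← coe_shiftHom hmaps, coe_mem_polySet]
    exact Ideal.mem_comap.1 (h hf)
  conv_lhs => rw [initialChain, initialIdeal_eq_span]
  rw [Ideal.span_le]
  rintro g ⟨a, ha, hg⟩
  refine Ideal.mem_comap.2
    (monomial_mem_initialIdeal (shiftExp_mem_leadSet hJ hT hmn hp ha) ?_)
  rw [coe_shiftHom, hg, shiftPoly_monomial]

theorem IsIncInvariantChain.initialChain {K : Type*} [Field K] {c : ℕ} {J : IdealSeq K c}
    (hJ : IsIncInvariantChain J) {T : TermOrder c} (hT : T.IncCompatible) :
    IsIncInvariantChain (initialChain T J) := by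
  refine ⟨fun m n hmn f hf => ?_, fun m n hmn p hp f hf =>
    shiftPoly_mem_initialChain hJ hT hmn hp hf⟩
  have := shiftPoly_mem_initialChain hJ hT hmn (id_mem_incMapsBetween hmn) hf
  simpa [shiftPoly] using this

/-- The pairs `(n, a)` such that `a` is a leading exponent vector of `J_n`. -/
def leadPairs {K : Type*} [Field K] {c : ℕ} (T : TermOrder c) (J : IdealSeq K c) :
    Set (ℕ+ × (VarIdx c →₀ ℕ)) :=
  {x | x.2 ∈ leadSet T (J x.1)}

theorem exists_finset_leadPairs {K : Type*} [Field K] {c : ℕ} (T : TermOrder c)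
    (J : IdealSeq K c) : ∃ G : Finset (ℕ+ × (VarIdx c →₀ ℕ)), (∀ x ∈ G, x ∈ leadPairs T J) ∧
      ∀ y ∈ leadPairs T J, ∃ x ∈ G, IncDvd x y :=
  exists_finset_incDvd _ fun _ hx => leadSet_subset_expOn _ _ hx

/-- From some level on, all leading monomials are multiples of shifts of leading monomials of
that level. -/
theorem exists_forall_leadSet_shift_le {K : Type*} [Field K] {c : ℕ} {J : IdealSeq K c}
    (hJ : IsIncInvariantChain J) {T : TermOrder c} (hT : T.IncCompatible) :
    ∃ N : ℕ+, ∀ n, N ≤ n → ∀ a ∈ leadSet T (J n),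
      ∃ b ∈ leadSet T (J N), ∃ p ∈ IncMapsBetween N n, shiftExp p b ≤ a := by
  obtain ⟨G, hG, hdvd⟩ := exists_finset_leadPairs T J
  -- The highest level of a generator; for empty `G` it is `1`, and there are no leading monomials.
  refine ⟨G.sup Prod.fst, fun n hn a ha => ?_⟩
  obtain ⟨x, hx, -, p, hp, hle⟩ := hdvd (n, a) ha
  have hxN : x.1 ≤ G.sup Prod.fst := Finset.le_sup (f := Prod.fst) hx
  obtain ⟨r, hr, q, hq, hqr⟩ := exists_comp_of_mem_incMapsBetween hxN hn hp
  refine ⟨shiftExp r x.2, shiftExp_mem_leadSet hJ hT hxN hr (hG x hx), q, hq, ?_⟩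
  rwa [shiftExp_comp, shiftExp_congr (p := q ∘ r) (A := Set.Iic x.1) (fun j hj => hqr j hj)
    (leadSet_subset_expOn _ _ (hG x hx))]

theorem exists_isStabilityIndex_initialChain {K : Type*} [Field K] {c : ℕ} {J : IdealSeq K c}
    (hJ : IsIncInvariantChain J) {T : TermOrder c} (hT : T.IncCompatible) :
    ∃ N, IsStabilityIndex (initialChain T J) N := by
  suffices h : (stableFrom (initialChain T J)).Nonempty from
    ⟨_, wellFounded_lt.min_mem _ h, fun _ hx => wellFounded_lt.min_le hx⟩
  obtain ⟨N, hN⟩ := exists_forall_leadSet_shift_le hJ hT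
  refine ⟨N, fun n hn => le_antisymm ?_ ?_⟩
  · rw [incSpan, Ideal.span_le]
    rintro g ⟨p, hp, f, hf, hg⟩
    exact coe_mem_polySet.1 (hg ▸ shiftPoly_mem_initialChain hJ hT hn hp hf)
  · conv_lhs => rw [initialChain, initialIdeal_eq_span]
    rw [Ideal.span_le]
    rintro ⟨g, hgmem⟩ ⟨a, ha, rfl⟩
    obtain ⟨b, hb, p, hp, hle⟩ := hN n hn a ha
    obtain ⟨d, rfl⟩ := exists_add_of_le hle
    have hd : d ∈ expOn c (Set.Iic n) := fun v hv => leadSet_subset_expOn _ _ ha v (by simp [hv])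
    have hpb := leadSet_subset_expOn _ _ (shiftExp_mem_leadSet hJ hT hn hp hb)
    let u : PolyRingOn K c (Set.Iic N) :=
      ⟨_, monomial_mem_polyRingOn (leadSet_subset_expOn _ _ hb) (1 : K)⟩
    let v : PolyRingOn K c (Set.Iic n) := ⟨_, monomial_mem_polyRingOn hpb (1 : K)⟩
    let w : PolyRingOn K c (Set.Iic n) := ⟨_, monomial_mem_polyRingOn hd (1 : K)⟩
    have hu : u ∈ initialChain T J N := monomial_mem_initialIdeal hb rfl
    have hv : v ∈ incSpan (initialChain T J) N n :=
      Ideal.subset_span ⟨p, hp, u, coe_mem_polySet.2 hu, (shiftPoly_monomial p b 1).symm⟩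
    -- The leading monomial is a shift of one from level `N`, times the cofactor `d`.
    have hvw : (⟨_, hgmem⟩ : PolyRingOn K c (Set.Iic n)) = v * w := by
      refine Subtype.ext ?_
      rw [MulMemClass.coe_mul, MvPolynomial.monomial_mul, one_mul]
    rw [SetLike.mem_coe, hvw]
    exact Ideal.mul_mem_right w _ hv

/-! ### Ultralimits of term orders and finiteness -/

/-- The limit of a family of term orders along an ultrafilter. -/
def TermOrder.ultraLimit {c : ℕ} {ι : Type*} (𝒰 : Ultrafilter ι) (T : ι → TermOrder c) :
    TermOrder c where
  le a b := ∀ᶠ i in (𝒰 : Filter ι), (T i).le a b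
  antisymm a b hab hba := by
    obtain ⟨i, h, h'⟩ := (hab.and hba).exists
    exact (T i).antisymm a b h h'
  trans a b d hab hbd := by
    filter_upwards [hab, hbd] with i using (T i).trans a b d
  -- Totality is what requires an ultrafilter instead of a mere filter.
  total a b := Ultrafilter.eventually_or.1 (.of_forall fun i => (T i).total a b)
  add_right a b d hab := by
    filter_upwards [hab] with i using (T i).add_right a b d
  one_le a := .of_forall fun i => (T i).one_le a

/-- Initial chains are locally constant with respect to the term order. -/
theorem eventually_initialChain_eq_ultraLimit {K : Type*} [Field K] {c : ℕ} {J : IdealSeq K c}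
    (hJ : IsIncInvariantChain J) {ι : Type*} (𝒰 : Ultrafilter ι) {T : ι → TermOrder c}
    (hT : ∀ i, (T i).IncCompatible) :
    ∀ᶠ i in (𝒰 : Filter ι), initialChain (T i) J = initialChain (.ultraLimit 𝒰 T) J := by
  obtain ⟨G, hG, hdvd⟩ := exists_finset_leadPairs (.ultraLimit 𝒰 T) J
  have hev : ∀ᶠ i in (𝒰 : Filter ι), ∀ x ∈ G, x.2 ∈ leadSet (T i) (J x.1) := by
    rw [Filter.eventually_all_finset]
    intro x hx
    obtain ⟨f, hf, ha, hmax⟩ := hG x hx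
    -- The same `f` serves as witness for almost all `i`, its support being finite.
    have : ∀ᶠ i in (𝒰 : Filter ι), ∀ b ∈ f.support, (T i).le b x.2 :=
      (Filter.eventually_all_finset _).2 hmax
    filter_upwards [this] with i hi using ⟨f, hf, ha, hi⟩
  filter_upwards [hev] with i hi
  funext n
  -- Generators are propagated using compatibility of `T i`, so none is needed for the limit order.
  -- One set of indices `i` serves all levels `n`.
  have hsub : leadSet (.ultraLimit 𝒰 T) (J n) ⊆ leadSet (T i) (J n) := by
    intro a ha
    obtain ⟨x, hx, hxa⟩ := hdvd (n, a) ha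
    exact mem_leadSet_of_incDvd (y := (n, a)) hJ (hT i) hxa (hi x hx)
      (leadSet_subset_expOn _ (J n) ha)
  exact (initialIdeal_congr (leadSet_eq_of_subset (Set.finite_Iic n) hsub)).symm

/-- Choose one order per chain and take their limit along a nonprincipal ultrafilter: almost all
chains would equal that of the limit, but at most one can. -/
theorem finite_initialChains {K : Type*} [Field K] {c : ℕ} {J : IdealSeq K c}
    (hJ : IsIncInvariantChain J) : (initialChains J).Finite := by
  by_contra hinf
  have : Infinite (initialChains J) := Set.infinite_coe_iff.2 hinf
  choose T hT hL using fun L : initialChains J => L.2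
  have hev := eventually_initialChain_eq_ultraLimit hJ (Filter.hyperfilter (initialChains J)) hT
  have hsub : {L : initialChains J | initialChain (T L) J =
      initialChain (.ultraLimit (Filter.hyperfilter (initialChains J)) T) J}.Subsingleton := by
    intro L hL₁ L' hL₂
    exact Subtype.ext ((hL L).trans ((hL₁.trans hL₂.symm).trans (hL L').symm))
  exact Filter.notMem_hyperfilter_of_finite hsub.finite hev

theorem bddAbove_initialStabilityIndices {K : Type*} [Field K] {c : ℕ} {J : IdealSeq K c}
    (hJ : IsIncInvariantChain J) : BddAbove (initialStabilityIndices J) := by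
  have hfin : (⋃ L ∈ initialChains J, {N | IsStabilityIndex L N}).Finite :=
    (finite_initialChains hJ).biUnion fun L _ =>
      Set.Subsingleton.finite fun N hN N' hN' => hN.unique hN'
  refine (hfin.subset ?_).bddAbove
  rintro N ⟨T, hT, hN⟩
  exact Set.mem_biUnion (⟨T, hT, rfl⟩ : initialChain T J ∈ initialChains J) hN

/-! ### Generation by intersections with few columns -/

theorem coe_incl {K : Type*} [Field K] {c : ℕ} {A B : Set ℕ+} (hAB : A ⊆ B)
    (f : PolyRingOn K c A) : (PolyRingOn.incl K c hAB f : BigRing K c) = f :=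
  Subalgebra.coe_inclusion _ f

theorem mem_polySet_interIdeal {K : Type*} [Field K] {c : ℕ} {A B : Set ℕ+} (hAB : A ⊆ B)
    {I : Ideal (PolyRingOn K c B)} {f : BigRing K c} :
    f ∈ polySet (interIdeal hAB I) ↔ f ∈ PolyRingOn K c A ∧ f ∈ polySet I := by
  have h (g : PolyRingOn K c A) : g ∈ interIdeal hAB I ↔ (g : BigRing K c) ∈ polySet I := by
    rw [interIdeal, Ideal.mem_comap, ← coe_mem_polySet, coe_incl]
  rw [mem_polySet]
  exact ⟨fun ⟨hfA, hf⟩ => ⟨hfA, (h _).1 hf⟩, fun ⟨hfA, hf⟩ => ⟨hfA, (h ⟨f, hfA⟩).2 hf⟩⟩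

theorem monomial_mem_map_incl {K : Type*} [Field K] {c : ℕ} {T : TermOrder c} {A B : Set ℕ+}
    (hAB : A ⊆ B) {I : Ideal (PolyRingOn K c B)} {f : BigRing K c} {a : VarIdx c →₀ ℕ}
    (hf : f ∈ polySet I) (hfA : f ∈ PolyRingOn K c A) (ha : T.IsLeadingExp f a)
    {g : PolyRingOn K c B} (hg : (g : BigRing K c) = MvPolynomial.monomial a 1) :
    g ∈ (initialIdeal T (interIdeal hAB I)).map (PolyRingOn.incl K c hAB) := by
  have hmem : a ∈ leadSet T (interIdeal hAB I) :=
    ⟨f, (mem_polySet_interIdeal hAB).2 ⟨hfA, hf⟩, ha⟩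
  let u : PolyRingOn K c A :=
    ⟨_, monomial_mem_polyRingOn (leadSet_subset_expOn _ _ hmem) (1 : K)⟩
  have hu : g = PolyRingOn.incl K c hAB u := Subtype.ext (hg.trans (coe_incl hAB u).symm)
  rw [hu]
  exact Ideal.mem_map_of_mem _ (monomial_mem_initialIdeal hmem rfl)

theorem map_incl_initialIdeal_le {K : Type*} [Field K] {c : ℕ} (T : TermOrder c) {A B : Set ℕ+}
    (hAB : A ⊆ B) (I : Ideal (PolyRingOn K c B)) :
    (initialIdeal T (interIdeal hAB I)).map (PolyRingOn.incl K c hAB) ≤ initialIdeal T I := by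
  rw [Ideal.map_le_iff_le_comap, initialIdeal_eq_span T (interIdeal hAB I), Ideal.span_le]
  rintro g ⟨a, ⟨f, hf, ha⟩, hg⟩
  have hmem : a ∈ leadSet T I := ⟨f, ((mem_polySet_interIdeal hAB).1 hf).2, ha⟩
  exact Ideal.mem_comap.2 (monomial_mem_initialIdeal hmem ((coe_incl hAB g).trans hg))

theorem card_Iic_pnat (n : ℕ+) : (Finset.Iic n).card = n := by
  have h : Finset.Iic n = Finset.Icc 1 n := by ext; simp
  rw [h, PNat.card_Icc]
  simp

/-- The initial ideal is generated by shifts `p · in(f)` with `f ∈ J_M`. Since `p · f ∈ J_n` lives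
on the columns `p([M])`, at most `M ≤ N` in number, it lies in `R_A` for some `N`-element set `A ⊆
[n]`. -/
theorem IsStabilityIndex.initialIdeal_le {K : Type*} [Field K] {c : ℕ} {J : IdealSeq K c}
    (hJ : IsIncInvariantChain J) {T : TermOrder c} (hT : T.IncCompatible) {M N n : ℕ+}
    (hM : IsStabilityIndex (_root_.initialChain T J) M) (hMN : M ≤ N) (hNn : N ≤ n) :
    initialIdeal T (J n) ≤
      ⨆ (A : Finset ℕ+) (hA : (A : Set ℕ+) ⊆ Set.Iic n) (_ : A.card = (N : ℕ)),
        (initialIdeal T (interIdeal hA (J n))).map (PolyRingOn.incl K c hA) := by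
  have hst : incSpan (_root_.initialChain T J) M n = initialIdeal T (J n) := hM.1 n (hMN.trans hNn)
  rw [← hst, incSpan, Ideal.span_le]
  rintro g ⟨p, hp, _, ⟨f, hf, rfl⟩, hg⟩
  have hmaps := mapsTo_Iic_of_mem_incMapsBetween hp
  obtain rfl : g = shiftHom K c hmaps f := Subtype.ext (hg.trans (coe_shiftHom hmaps f).symm)
  have hcard : ((Finset.Iic M).image p).card ≤ (N : ℕ) :=
    Finset.card_image_le.trans (by simpa [card_Iic_pnat] using hMN)
  have hsub : (Finset.Iic M).image p ⊆ Finset.Iic n := by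
    intro j hj
    obtain ⟨i, hi, rfl⟩ := Finset.mem_image.1 hj
    exact Finset.mem_Iic.2 (hmaps (Finset.mem_Iic.1 hi))
  obtain ⟨A, hpA, hAn, hAcard⟩ := Finset.exists_subsuperset_card_eq hsub hcard
    (by simpa [card_Iic_pnat] using hNn)
  have hA : (A : Set ℕ+) ⊆ Set.Iic n := fun j hj => Finset.mem_Iic.1 (hAn hj)
  refine le_iSup₂_of_le (f := fun (A : Finset ℕ+) (hA : (A : Set ℕ+) ⊆ Set.Iic n) =>
    ⨆ _ : A.card = (N : ℕ), (initialIdeal T (interIdeal hA (J n))).map (PolyRingOn.incl K c hA))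
    A hA (le_iSup_of_le hAcard le_rfl) ?_
  -- Pulling back along the shift reduces from an arbitrary element of the initial ideal to leading
  -- monomials.
  suffices h : _root_.initialChain T J M ≤ ((initialIdeal T (interIdeal hA (J n))).map
      (PolyRingOn.incl K c hA)).comap (shiftHom K c hmaps) from Ideal.mem_comap.1 (h hf)
  conv_lhs => rw [_root_.initialChain, initialIdeal_eq_span]
  rw [Ideal.span_le]
  rintro g ⟨a, ⟨f, hf, hfa⟩, hg⟩
  have hpA' : Set.MapsTo p (Set.Iic M) A := fun j hj =>
    hpA (Finset.mem_image_of_mem p (Finset.mem_Iic.2 hj))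
  refine Ideal.mem_comap.2 (monomial_mem_map_incl hA (hJ.2 M n (hMN.trans hNn) p hp f hf)
    (shiftPoly_mem_polyRingOn hpA' (mem_polySet.1 hf).1) (hfa.shift hT hp.1) ?_)
  rw [coe_shiftHom, hg, shiftPoly_monomial]

theorem initialIdealsGeneratedByIntersections {K : Type*} [Field K] {c : ℕ} {J : IdealSeq K c}
    (hJ : IsIncInvariantChain J) : InitialIdealsGeneratedByIntersections J := by
  obtain ⟨N, hN⟩ := bddAbove_initialStabilityIndices hJ
  refine ⟨N, fun n hn T hT => le_antisymm ?_ ?_⟩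
  · obtain ⟨M, hM⟩ := exists_isStabilityIndex_initialChain hJ hT
    exact hM.initialIdeal_le hJ hT (hN ⟨T, hT, hM⟩) hn
  · exact iSup_le fun A => iSup_le fun hA => iSup_le fun _ => map_incl_initialIdeal_le T hA (J n)

theorem mainTheorem2 {K : Type*} [Field K] (c : ℕ) (J : IdealSeq K c)
    (hJ : IsIncInvariantChain J) :
    -- all initial ideal chains stabilize, so that the set of stability indices is meaningful
    (∀ T : TermOrder c, T.IncCompatible →
      IsIncInvariantChain (initialChain T J) ∧ ∃ N, IsStabilityIndex (initialChain T J) N) ∧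
    -- (1) and (2) are equivalent
    (BddAbove (initialStabilityIndices J) ↔ (initialChains J).Finite) ∧
    -- each of them implies (3)
    (BddAbove (initialStabilityIndices J) → InitialIdealsGeneratedByIntersections J) ∧
    ((initialChains J).Finite → InitialIdealsGeneratedByIntersections J) ∧
    -- for symmetric chains, (3) is equivalent to (1) and to (2)
    (IsSymInvariantChain J →
      (InitialIdealsGeneratedByIntersections J ↔ BddAbove (initialStabilityIndices J)) ∧
      (InitialIdealsGeneratedByIntersections J ↔ (initialChains J).Finite)) ∧
    -- all three conditions hold
    (BddAbove (initialStabilityIndices J) ∧ (initialChains J).Finite ∧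
      InitialIdealsGeneratedByIntersections J) := by
  have h1 := bddAbove_initialStabilityIndices hJ
  have h2 := finite_initialChains hJ
  have h3 := initialIdealsGeneratedByIntersections hJ
  exact ⟨fun T hT => ⟨hJ.initialChain hT, exists_isStabilityIndex_initialChain hJ hT⟩,
    iff_of_true h1 h2, fun _ => h3, fun _ => h3,
    fun _ => ⟨iff_of_true h3 h1, iff_of_true h3 h2⟩, h1, h2, h3⟩
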